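/- For a tempered distribution $u$ on $\mathbb R\times\mathbb R$, with variables $(t,x)$, let $\widetilde u(\tau,\xi)=\int\int e^{-i(x\xi+t\tau)}u(t,x)\,dt\,dx$ denote its space-time Fourier transform (in the sense of tempered distributions), and put $\langle y\rangle=1+|y|$. For $s,b\in\mathbb R$ let $$\|u\|_{X_{s,b}}=\big\|\langle\tau-\xi^3\rangle^{b}\,\langle\xi\rangle^{s}\,\widetilde u(\tau,\xi)\big\|_{L^2_{\xi,\tau}}$$ (with $\|u\|_{X_{s,b}}=\infty$ if $\widetilde u$ is not a function), and let $X_{s,b}$ be the space of all $u$ with $\|u\|_{X_{s,b}}<\infty$. **Lemma.** Let $s>\frac12$ and $b>\frac12$. There is a constant $C>0$, depending only on $s$ and $b$, such that for every $b'$ with $-\frac12<b'\le 0$ and all complex-valued $u_1,\dots,u_5\in X_{s,b}$ the following holds: each $u_j$ is given by a function, the pointwise product $u_1\cdots u_5$ of these functions defines a tempered distribution, and $$\Big\|\partial_x\Big(\prod_{j=1}^5u_j\Big)\Big\|_{X_{s,b'}}\le C\prod_{j=1}^5\|u_j\|_{X_{s,b}},$$ where $\partial_x$ is the distributional derivative.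 -/

import Mathlib

open scoped SchwartzMap ENNReal FourierTransform LineDeriv

noncomputable section

/-- Space-time `ℝ × ℝ` with its Euclidean structure; a point is `(t, x) = (p 0, p 1)` and a
frequency is `(τ, ξ) = (ζ 0, ζ 1)`. -/
abbrev Spacetime : Type := EuclideanSpace ℝ (Fin 2)

/-- The tempered distribution `T` is (given by integration against) the function `f`. -/
def IsGivenBy (T : 𝓢'(Spacetime, ℂ)) (f : Spacetime → ℂ) : Prop :=
  ∀ φ : 𝓢(Spacetime, ℂ),
    MeasureTheory.Integrable (fun p => φ p * f p) ∧ T φ = ∫ p, φ p * f p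

/-- The bracket `⟨y⟩ = 1 + |y|`. -/
def bracket (y : ℝ) : ℝ := 1 + |y|

/-- The weight `⟨τ - ξ³⟩ ^ b * ⟨ξ⟩ ^ s` adapted to the Airy equation `u_t + u_xxx = 0`. -/
def bourgainWeight (s b : ℝ) (ζ : Spacetime) : ℝ :=
  bracket (ζ 0 - ζ 1 ^ 3) ^ b * bracket (ζ 1) ^ s

/-- The function `ũ (τ, ξ) = ∫∫ exp (-i (x ξ + t τ)) u (t, x) dt dx` is the Fourier transform of `T`,
in the sense of tempered distributions: in terms of Mathlib's transform `𝓕`, whose kernel is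
`exp (-2 π i ⟪p, ζ⟫)`, this says that `𝓕 T` is the function `ζ ↦ ũ (2 π ζ)`. -/
def HasFourierFunction (T : 𝓢'(Spacetime, ℂ)) (u' : Spacetime → ℂ) : Prop :=
  IsGivenBy (𝓕 T) (fun ζ => u' ((2 * Real.pi) • ζ))

/-- The Bourgain norm `‖T‖_{X_{s,b}} = ‖⟨τ - ξ³⟩ ^ b ⟨ξ⟩ ^ s ũ‖_{L²}` of a tempered distribution,
equal to `∞` if the Fourier transform `ũ` of `T` is not a function. As `ũ` is unique up to
null sets, the infimum only selects the common value. -/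
def bourgainNorm (s b : ℝ) (T : 𝓢'(Spacetime, ℂ)) : ℝ≥0∞ :=
  ⨅ (u' : Spacetime → ℂ) (_ : HasFourierFunction T u'),
    MeasureTheory.eLpNorm (fun ζ => (bourgainWeight s b ζ : ℂ) * u' ζ) 2

/-- The space `X_{s,b}` of tempered distributions with finite Bourgain norm. -/
def MemBourgain (s b : ℝ) (T : 𝓢'(Spacetime, ℂ)) : Prop := bourgainNorm s b T < ∞

/-- The distributional space derivative `∂_x`. -/
def spaceDeriv (T : 𝓢'(Spacetime, ℂ)) : 𝓢'(Spacetime, ℂ) :=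
  ∂_{(EuclideanSpace.single (1 : Fin 2) (1 : ℝ) : Spacetime)} T

end

open MeasureTheory

noncomputable section

/-! On the Fourier side the product becomes a fivefold convolution of the transforms `v j`. As b' ≤
0, the factor ⟨τ - ξ³⟩ ^ b' is at most 1 and is dropped, so the constant does not depend on b'.
Write |v j|² = W F_j with W = ⟨τ - ξ³⟩^(-2b) ⟨ξ⟩^(-2s); up to powers of 2π, ∫ F_j is the squared
norm of `U j`. Since s, b > 1/2, W is integrable, hence so is `v j`, and `U j` is the function `𝓕⁻
(v j)`. Cauchy–Schwarz gives |v₀ ⋆ ⋯ ⋆ v₄|² ≤ (W ⋆ ⋯ ⋆ W)(F₀ ⋆ ⋯ ⋆ F₄), so everything reduces to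
boundedness of ξ² ⟨ξ⟩^(2s) (W ⋆ ⋯ ⋆ W), proved in dual form in `exists_lintegral_quinticKernel_le`.

By symmetry let ξ₄ be the largest frequency. Its weight absorbs ⟨ξ⟩^(2s), and a factor ⟨ξ₄⟩²
remains. If ⟨ξ₄⟩² ⟨ξ_j⟩^(-2s) ≲ |ξ₄² - ξ_j²| for some j in {1, 2, 3}, the right side is, up to a
constant, the Jacobian of the resonance function ξ₄³ + ξ_j³ at fixed ξ₄ + ξ_j, and a change of
variables absorbs it (`lintegral_pair_le`). Otherwise |ξ₁|, |ξ₂|, |ξ₃| all lie within 1 of |ξ₄|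
(`near_of_not_transversal`): two of the weights absorb ⟨ξ₄⟩², and their frequencies range over sets
of bounded measure. -/

lemma bracket_pos (y : ℝ) : 0 < bracket y := by unfold bracket; positivity

lemma one_le_bracket (y : ℝ) : 1 ≤ bracket y := by
  unfold bracket; linarith [abs_nonneg y]

lemma continuous_bracket : Continuous bracket := by unfold bracket; fun_prop

/-! ### Weights and iterated integrals. -/

/-- The integrable weight `⟨y⟩ ^ (-2r)`. -/
def decay (r y : ℝ) : ℝ := bracket y ^ (-(2 * r))

lemma decay_pos (r y : ℝ) : 0 < decay r y := Real.rpow_pos_of_pos (bracket_pos y) _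

lemma continuous_decay (r : ℝ) : Continuous (decay r) :=
  continuous_bracket.rpow_const fun y => Or.inl (bracket_pos y).ne'

@[fun_prop]
lemma measurable_decay (r : ℝ) : Measurable (decay r) := (continuous_decay r).measurable

lemma decay_le_one {r : ℝ} (hr : 0 ≤ r) (y : ℝ) : decay r y ≤ 1 :=
  Real.rpow_le_one_of_one_le_of_nonpos (one_le_bracket y) (by linarith)

lemma decay_le_inv_bracket {r : ℝ} (hr : 1 / 2 ≤ r) (y : ℝ) : decay r y ≤ (bracket y)⁻¹ := by
  rw [← Real.rpow_neg_one]
  exact Real.rpow_le_rpow_of_exponent_le (one_le_bracket y) (by linarith)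

lemma lintegral_decay_lt_top {r : ℝ} (hr : 1 / 2 < r) :
    ∫⁻ y, ENNReal.ofReal (decay r y) < ∞ := by
  have := finite_integral_one_add_norm (E := ℝ) (μ := volume) (r := 2 * r) (by simp; linarith)
  simpa [decay, bracket, Real.norm_eq_abs] using this

@[fun_prop]
lemma measurable_spacetime_apply (i : Fin 2) : Measurable fun ζ : Spacetime => ζ i :=
  (by fun_prop : Continuous fun ζ : Spacetime => ζ i).measurable

/-- Integration over space-time, first in `τ` and then in `ξ`. -/
lemma lintegral_spacetime {F : Spacetime → ℝ≥0∞} (hF : Measurable F) :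
    ∫⁻ ζ, F ζ = ∫⁻ ξ : ℝ, ∫⁻ τ : ℝ, F !₂[τ, ξ] := by
  have h1 := (PiLp.volume_preserving_toLp (Fin 2)).lintegral_comp hF
  have hG : Measurable fun y : Fin 2 → ℝ => F (WithLp.toLp 2 y) :=
    hF.comp (PiLp.volume_preserving_toLp (Fin 2)).measurable
  have h2 := (volume_preserving_finTwoArrow ℝ).symm.lintegral_comp hG
  rw [← h1, ← h2, Measure.volume_eq_prod, lintegral_prod_symm]
  · rfl
  · exact (hG.comp (MeasurableEquiv.measurable _)).aemeasurable

lemma lintegral_fin_succ {α : Type*} [MeasureSpace α] [SigmaFinite (volume : Measure α)] {n : ℕ}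
    {F : (Fin (n + 1) → α) → ℝ≥0∞} (hF : Measurable F) :
    ∫⁻ z, F z = ∫⁻ x : α, ∫⁻ z : Fin n → α, F (Matrix.vecCons x z) := by
  have h := (volume_preserving_piFinSuccAbove (fun _ : Fin (n + 1) => α) 0).symm.lintegral_comp hF
  rw [← h, Measure.volume_eq_prod, lintegral_prod]
  · congr! with x z
    simp [MeasurableEquiv.piFinSuccAbove, Matrix.vecCons]
    rfl
  · exact (hF.comp (MeasurableEquiv.measurable _)).aemeasurable

@[fun_prop]
lemma measurable_vecCons {α β : Type*} [MeasurableSpace α] [MeasurableSpace β] {n : ℕ}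
    {f : β → α} {g : β → Fin n → α} (hf : Measurable f) (hg : Measurable g) :
    Measurable fun x => (Matrix.vecCons (f x) (g x) : Fin (n + 1) → α) := by
  refine measurable_pi_iff.2 fun i => ?_
  refine Fin.cases ?_ (fun j => ?_) i
  · simpa using hf
  · simpa [Function.comp_def] using (measurable_pi_apply j).comp hg

lemma lintegral_fin_five {α : Type*} [MeasureSpace α] [SigmaFinite (volume : Measure α)]
    {F : (Fin 5 → α) → ℝ≥0∞} (hF : Measurable F) :
    ∫⁻ z, F z = ∫⁻ z₀ : α, ∫⁻ z₁ : α, ∫⁻ z₂ : α, ∫⁻ z₃ : α, ∫⁻ z₄ : α,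
      F ![z₀, z₁, z₂, z₃, z₄] := by
  rw [lintegral_fin_succ hF]
  congr! 2 with z₀
  rw [lintegral_fin_succ (by fun_prop)]
  congr! 2 with z₁
  rw [lintegral_fin_succ (by fun_prop)]
  congr! 2 with z₂
  rw [lintegral_fin_succ (by fun_prop)]
  congr! 2 with z₃
  rw [lintegral_fin_succ (by fun_prop)]
  congr! 2 with z₄
  simp only [lintegral_unique, volume_pi, Measure.pi_univ]
  simp
  congr!

/-- The modulation weight `⟨τ - ξ³⟩ ^ (-2b)`. -/
def modDecay (b : ℝ) (ζ : Spacetime) : ℝ := decay b (ζ 0 - ζ 1 ^ 3)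

lemma modDecay_pos (b : ℝ) (ζ : Spacetime) : 0 < modDecay b ζ := decay_pos _ _

@[fun_prop]
lemma measurable_modDecay (b : ℝ) : Measurable (modDecay b) := by unfold modDecay; fun_prop

/-- The inverse square of `bourgainWeight`. -/
def invWeightSq (s b : ℝ) (ζ : Spacetime) : ℝ := modDecay b ζ * decay s (ζ 1)

lemma invWeightSq_pos (s b : ℝ) (ζ : Spacetime) : 0 < invWeightSq s b ζ :=
  mul_pos (modDecay_pos _ _) (decay_pos _ _)

@[fun_prop]
lemma measurable_invWeightSq (s b : ℝ) : Measurable (invWeightSq s b) := by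
  unfold invWeightSq; fun_prop

lemma bourgainWeight_pos (s b : ℝ) (ζ : Spacetime) : 0 < bourgainWeight s b ζ :=
  mul_pos (Real.rpow_pos_of_pos (bracket_pos _) _) (Real.rpow_pos_of_pos (bracket_pos _) _)

lemma invWeightSq_mul_sq (s b : ℝ) (ζ : Spacetime) :
    invWeightSq s b ζ * bourgainWeight s b ζ ^ 2 = 1 := by
  have key : ∀ r y : ℝ, decay r y * (bracket y ^ r) ^ 2 = 1 := fun r y => by
    rw [decay, ← Real.rpow_mul_natCast (bracket_pos y).le, ← Real.rpow_add (bracket_pos y)]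
    convert Real.rpow_zero _ using 2
    push_cast; ring
  have h1 := key b (ζ 0 - ζ 1 ^ 3)
  have h2 := key s (ζ 1)
  rw [invWeightSq, modDecay, bourgainWeight]
  linear_combination h1 * (decay s (ζ 1) * (bracket (ζ 1) ^ s) ^ 2) + h2

lemma lintegral_modDecay_mul (b : ℝ) {f : ℝ → ℝ≥0∞} (hf : Measurable f) :
    ∫⁻ ζ : Spacetime, ENNReal.ofReal (modDecay b ζ) * f (ζ 1) =
      (∫⁻ y, ENNReal.ofReal (decay b y)) * ∫⁻ ξ, f ξ := by
  rw [lintegral_spacetime (by fun_prop), ← lintegral_const_mul _ hf]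
  congr! 2 with ξ
  simp only [modDecay, Matrix.cons_val_zero, Matrix.cons_val_one]
  rw [lintegral_mul_const _ (by fun_prop),
    lintegral_sub_right_eq_self (fun y => ENNReal.ofReal (decay b y))]

lemma lintegral_invWeightSq_lt_top {s b : ℝ} (hs : 1 / 2 < s) (hb : 1 / 2 < b) :
    ∫⁻ ζ, ENNReal.ofReal (invWeightSq s b ζ) < ∞ := by
  simp_rw [invWeightSq, ENNReal.ofReal_mul (modDecay_pos _ _).le]
  rw [lintegral_modDecay_mul b (f := fun ξ => ENNReal.ofReal (decay s ξ)) (by fun_prop)]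
  exact ENNReal.mul_lt_top (lintegral_decay_lt_top hb) (lintegral_decay_lt_top hs)

/-! ### Change of variables along the resonance function. -/

lemma lintegral_abs_deriv_mul_le {φ φ' : ℝ → ℝ} {c : ℝ} (hφ : ∀ x, HasDerivAt φ (φ' x) x)
    (h1 : Set.InjOn φ (Set.Iic c)) (h2 : Set.InjOn φ (Set.Ioi c)) (G : ℝ → ℝ≥0∞) :
    ∫⁻ x, ENNReal.ofReal |φ' x| * G (φ x) ≤ 2 * ∫⁻ y, G y := by
  have key : ∀ s : Set ℝ, MeasurableSet s → Set.InjOn φ s →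
      ∫⁻ x in s, ENNReal.ofReal |φ' x| * G (φ x) ≤ ∫⁻ y, G y := fun s hs hi => by
    rw [← lintegral_image_eq_lintegral_abs_deriv_mul hs (fun x _ => (hφ x).hasDerivWithinAt) hi]
    exact setLIntegral_le_lintegral _ _
  rw [← lintegral_add_compl _ (measurableSet_Iic (a := c)), two_mul]
  refine add_le_add (key _ measurableSet_Iic h1) ?_
  rw [Set.compl_Iic]
  exact key _ measurableSet_Ioi h2

/-- The cubic terms cancel, so for c ≠ 0 the argument of G is quadratic in x and symmetric about c /
2. It is therefore two-to-one, and the prefactor is a third of its Jacobian. -/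
lemma lintegral_resonance_le (a c : ℝ) (G : ℝ → ℝ≥0∞) :
    ∫⁻ x, ENNReal.ofReal |(c - x) ^ 2 - x ^ 2| * G (a - (c - x) ^ 3 - x ^ 3) ≤
      2 * ∫⁻ y, G y := by
  rcases eq_or_ne c 0 with rfl | hc
  · simp
  have hinj : ∀ x y : ℝ, a - (c - x) ^ 3 - x ^ 3 = a - (c - y) ^ 3 - y ^ 3 →
      x = y ∨ x + y = c := fun x y h => by
    have : c * ((x - y) * (x + y - c)) = 0 := by linear_combination (-1 / 3) * h
    rcases mul_eq_zero.1 ((mul_eq_zero.1 this).resolve_left hc) with h | h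
    · left; linarith
    · right; linarith
  calc _ ≤ ∫⁻ x, ENNReal.ofReal |3 * (c - x) ^ 2 - 3 * x ^ 2| * G (a - (c - x) ^ 3 - x ^ 3) := by
        refine lintegral_mono fun x => mul_le_mul_left (ENNReal.ofReal_le_ofReal ?_) _
        rw [← mul_sub, abs_mul, abs_of_pos (by norm_num : (0 : ℝ) < 3)]
        linarith [abs_nonneg ((c - x) ^ 2 - x ^ 2)]
    _ ≤ _ := by
        refine lintegral_abs_deriv_mul_le (φ := fun x => a - (c - x) ^ 3 - x ^ 3) (c := c / 2)
          (fun x => ?_) (fun x hx y hy h => ?_) (fun x hx y hy h => ?_) G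
        · have h1 : HasDerivAt (fun x : ℝ => c - x) (-1) x := by
            simpa using (hasDerivAt_id x).const_sub c
          convert! ((h1.pow 3).const_sub a).sub ((hasDerivAt_id x).pow 3) using 1
          simp
        · rcases hinj x y h with h | h
          · exact h
          · simp only [Set.mem_Iic] at hx hy; linarith
        · rcases hinj x y h with h | h
          · exact h
          · simp only [Set.mem_Ioi] at hx hy; linarith

lemma lintegral_pair_le (b : ℝ) (ζ : Spacetime) :
    ∫⁻ z : Spacetime, ENNReal.ofReal |(ζ 1 - z 1) ^ 2 - z 1 ^ 2| *
        (ENNReal.ofReal (modDecay b (ζ - z)) * ENNReal.ofReal (modDecay b z)) ≤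
      2 * (∫⁻ y, ENNReal.ofReal (decay b y)) ^ 2 := by
  set h : ℝ → ℝ≥0∞ := fun y => ENNReal.ofReal (decay b y) with hdef
  have hh : Measurable h := by fun_prop
  rw [lintegral_spacetime (by fun_prop)]
  calc _ = ∫⁻ ξ : ℝ, ENNReal.ofReal |(ζ 1 - ξ) ^ 2 - ξ ^ 2| *
        (fun y => ∫⁻ τ : ℝ, h (y - τ) * h τ) (ζ 0 - (ζ 1 - ξ) ^ 3 - ξ ^ 3) := by
        congr! 2 with ξ
        simp only [modDecay, PiLp.sub_apply, Matrix.cons_val_zero,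
          Matrix.cons_val_one]
        rw [lintegral_const_mul _ (by fun_prop)]
        congr 1
        -- The shift τ ↦ τ - ξ³ turns the τ-integral into the self-convolution of `h` at the
        -- resonance function.
        refine Eq.trans ?_ (lintegral_sub_right_eq_self
          (fun τ => h (ζ 0 - (ζ 1 - ξ) ^ 3 - ξ ^ 3 - τ) * h τ) (ξ ^ 3))
        refine lintegral_congr fun τ => ?_
        simp only [hdef]
        congr 3
        ring
    _ ≤ 2 * ∫⁻ y, ∫⁻ τ : ℝ, h (y - τ) * h τ := lintegral_resonance_le _ _ _
    _ = _ := by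
        congr 1
        rw [lintegral_lintegral_swap (by fun_prop)]
        calc _ = ∫⁻ τ, (∫⁻ y, h y) * h τ := by
              congr! 2 with τ
              rw [lintegral_mul_const _ (by fun_prop), lintegral_sub_right_eq_self h]
          _ = _ := by rw [lintegral_const_mul _ hh, sq]

/-! ### Near frequencies and pointwise bounds for the quintic kernel. -/

lemma lintegral_abs_abs_sub_le (c : ℝ) :
    ∫⁻ x : ℝ, Set.indicator {x : ℝ | |(|x| - |c|)| ≤ 1} 1 x ≤ 4 := by
  have hm : MeasurableSet {x : ℝ | |(|x| - |c|)| ≤ 1} :=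
    (isClosed_le (by fun_prop) continuous_const).measurableSet
  rw [lintegral_indicator_one hm]
  calc _ ≤ volume (Set.Icc (c - 1) (c + 1) ∪ Set.Icc (-c - 1) (-c + 1)) := by
        refine measure_mono fun x hx => ?_
        simp only [Set.mem_ofPred_eq, abs_le] at hx
        simp only [Set.mem_union, Set.mem_Icc]
        rcases abs_cases x with h | h <;> rcases abs_cases c with h' | h' <;>
          first
          | (left; constructor <;> linarith)
          | (right; constructor <;> linarith)
    _ ≤ _ := measure_union_le _ _
    _ = 4 := by
        simp only [Real.volume_Icc]
        rw [← ENNReal.ofReal_add (by linarith) (by linarith)]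
        ring_nf
        simp

/-- The squared multiplier `(|ξ| ⟨ξ⟩ ^ s) ^ 2` of the derivative of the product. -/
def derivWeightSq (s x : ℝ) : ℝ := (|x| * bracket x ^ s) ^ 2

@[fun_prop]
lemma measurable_derivWeightSq (s : ℝ) : Measurable (derivWeightSq s) := by
  have : Continuous (derivWeightSq s) :=
    (continuous_abs.mul (continuous_bracket.rpow_const fun y => Or.inl (bracket_pos y).ne')).pow 2
  exact this.measurable

/-- The indicator of `||x| - |y|| ≤ 1`. -/
def nearIndicator (x y : ℝ) : ℝ := if |(|x| - |y|)| ≤ 1 then 1 else 0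

lemma nearIndicator_nonneg (x y : ℝ) : 0 ≤ nearIndicator x y := by
  unfold nearIndicator; split_ifs <;> norm_num

@[fun_prop]
lemma Measurable.nearIndicator {α : Type*} [MeasurableSpace α] {f g : α → ℝ}
    (hf : Measurable f) (hg : Measurable g) : Measurable fun a => nearIndicator (f a) (g a) := by
  unfold _root_.nearIndicator
  exact Measurable.ite (measurableSet_le (by fun_prop) (by fun_prop)) (by fun_prop) (by fun_prop)

lemma lintegral_nearIndicator_le (c : ℝ) : ∫⁻ x, ENNReal.ofReal (nearIndicator x c) ≤ 4 := by
  refine le_trans (le_of_eq ?_) (lintegral_abs_abs_sub_le c)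
  refine lintegral_congr fun x => ?_
  by_cases h : |(|x| - |c|)| ≤ 1 <;> simp [nearIndicator, Set.indicator, h]

/-- Majorant where the frequencies of the last two factors are well separated. -/
def transversalKernel (s b : ℝ) (z : Fin 5 → Spacetime) : ℝ :=
  invWeightSq s b (z 0) * (invWeightSq s b (z 1) * (invWeightSq s b (z 2) *
    (|z 4 1 ^ 2 - z 3 1 ^ 2| * (modDecay b (z 4) * modDecay b (z 3)))))

/-- Majorant where all large frequencies have nearly the same size. -/
def parallelKernel (s b : ℝ) (z : Fin 5 → Spacetime) : ℝ :=
  invWeightSq s b (z 0) * (invWeightSq s b (z 1) *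
    ((modDecay b (z 2) * nearIndicator (z 2 1) (z 1 1)) *
      (modDecay b (z 3) * nearIndicator (z 3 1) (z 1 1))))

lemma transversalKernel_nonneg (s b : ℝ) (z : Fin 5 → Spacetime) :
    0 ≤ transversalKernel s b z :=
  mul_nonneg (invWeightSq_pos _ _ _).le <| mul_nonneg (invWeightSq_pos _ _ _).le <|
    mul_nonneg (invWeightSq_pos _ _ _).le <| mul_nonneg (abs_nonneg _) <|
      mul_nonneg (modDecay_pos _ _).le (modDecay_pos _ _).le

lemma parallelKernel_nonneg (s b : ℝ) (z : Fin 5 → Spacetime) : 0 ≤ parallelKernel s b z :=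
  mul_nonneg (invWeightSq_pos _ _ _).le <| mul_nonneg (invWeightSq_pos _ _ _).le <|
    mul_nonneg (mul_nonneg (modDecay_pos _ _).le (nearIndicator_nonneg _ _))
      (mul_nonneg (modDecay_pos _ _).le (nearIndicator_nonneg _ _))

@[fun_prop]
lemma measurable_transversalKernel (s b : ℝ) : Measurable (transversalKernel s b) := by
  unfold transversalKernel
  fun_prop

@[fun_prop]
lemma measurable_parallelKernel (s b : ℝ) : Measurable (parallelKernel s b) := by
  unfold parallelKernel
  fun_prop

/-- With a = |x|, c = |y| and 2s ≥ 1, the hypothesis gives 8 (a² - c²)(1 + c) < (1 + a)². Both 1 + a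
> 2 (1 + c) and a - c > 1 would make the left side too large; excluding the second uses the
exclusion of the first. -/
lemma near_of_not_transversal {s : ℝ} (hs : 1 / 2 ≤ s) {x y : ℝ} (hyx : |y| ≤ |x|)
    (h : ¬ bracket x ^ 2 * decay s y ≤ 8 * |x ^ 2 - y ^ 2|) :
    bracket x ≤ 2 * bracket y ∧ |x| - |y| ≤ 1 := by
  rw [not_le, ← sq_abs x, ← sq_abs y] at h
  have hy := abs_nonneg y
  have h1 := decay_le_inv_bracket hs y
  unfold bracket at *
  generalize |x| = a at *
  generalize |y| = c at *
  rw [abs_of_nonneg (by nlinarith)] at h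
  have hc : 0 < 1 + c := by linarith
  have ha : 0 ≤ a := by linarith
  have h2 : 8 * (a ^ 2 - c ^ 2) * (1 + c) < (1 + a) ^ 2 := by
    calc 8 * (a ^ 2 - c ^ 2) * (1 + c) < (1 + a) ^ 2 * decay s y * (1 + c) :=
          mul_lt_mul_of_pos_right h hc
      _ ≤ (1 + a) ^ 2 * (1 + c)⁻¹ * (1 + c) := by gcongr
      _ = (1 + a) ^ 2 := by field_simp
  have hfac : 8 * (a ^ 2 - c ^ 2) * (1 + c) = (a - c) * ((a + c) * (8 * (1 + c))) := by ring
  rw [hfac] at h2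
  have h3 : 1 + a ≤ 2 * (1 + c) := by
    by_contra! h3
    have h4 : 4 * (1 + a) ≤ (a + c) * (8 * (1 + c)) := by nlinarith
    have h5 : (1 + a) / 2 ≤ a - c := by linarith
    have := mul_le_mul h5 h4 (by linarith) (by linarith)
    nlinarith
  refine ⟨h3, ?_⟩
  by_contra! h4
  have h5 : 2 * (1 + a) * (1 + a) ≤ (a + c) * (8 * (1 + c)) := by nlinarith
  have := mul_le_mul h4.le h5 (by positivity) (by linarith)
  nlinarith

lemma bracket_add_le (x y : ℝ) : bracket (x + y) ≤ bracket x + bracket y := by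
  unfold bracket; linarith [abs_add_le x y]

/-- The integrand of the fivefold convolution of `invWeightSq`, with the output multiplier. -/
def quinticKernel (s b : ℝ) (z : Fin 5 → Spacetime) : ℝ :=
  derivWeightSq s (∑ i, z i 1) * ∏ i, invWeightSq s b (z i)

lemma quinticKernel_comp_perm (s b : ℝ) (z : Fin 5 → Spacetime) (σ : Equiv.Perm (Fin 5)) :
    quinticKernel s b (z ∘ σ) = quinticKernel s b z := by
  unfold quinticKernel
  simp only [Function.comp_apply]
  rw [Equiv.sum_comp σ (fun i => z i 1), Equiv.prod_comp σ (fun i => invWeightSq s b (z i))]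

/-- The output bracket is at most five times the largest input bracket, whose power 2s cancels
against `decay s (z 4 1)`. -/
lemma quinticKernel_le_of_max {s b : ℝ} (hs : 0 ≤ s) {z : Fin 5 → Spacetime}
    (hz : ∀ i, |z i 1| ≤ |z 4 1|) :
    quinticKernel s b z ≤ (5 ^ 2 * 5 ^ (2 * s)) * (bracket (z 4 1) ^ 2 * (modDecay b (z 4) *
      (invWeightSq s b (z 0) * (invWeightSq s b (z 1) *
        (invWeightSq s b (z 2) * invWeightSq s b (z 3)))))) := by
  have hb : ∀ i, bracket (z i 1) ≤ bracket (z 4 1) := fun i => by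
    unfold bracket; linarith [hz i]
  set X := ∑ i, z i 1 with hX
  have hp := bracket_pos X
  have h4 := bracket_pos (z 4 1)
  have hXb : bracket X ≤ 5 * bracket (z 4 1) := by
    rw [hX, Fin.sum_univ_five]
    have := bracket_add_le (z 0 1 + z 1 1 + z 2 1 + z 3 1) (z 4 1)
    have := bracket_add_le (z 0 1 + z 1 1 + z 2 1) (z 3 1)
    have := bracket_add_le (z 0 1 + z 1 1) (z 2 1)
    have := bracket_add_le (z 0 1) (z 1 1)
    linarith [hb 0, hb 1, hb 2, hb 3]
  have h1 : derivWeightSq s X ≤ (5 ^ 2 * bracket (z 4 1) ^ 2) *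
      (5 ^ (2 * s) * bracket (z 4 1) ^ (2 * s)) := by
    calc derivWeightSq s X = |X| ^ 2 * bracket X ^ (2 * s) := by
          rw [derivWeightSq, mul_pow, ← Real.rpow_mul_natCast hp.le]
          congr 2; push_cast; ring
      _ ≤ (5 * bracket (z 4 1)) ^ 2 * (5 * bracket (z 4 1)) ^ (2 * s) := by
          gcongr
          refine le_trans ?_ hXb
          unfold bracket; linarith
      _ = _ := by rw [Real.mul_rpow (by norm_num) h4.le, mul_pow]
  have h2 : bracket (z 4 1) ^ (2 * s) * decay s (z 4 1) = 1 := by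
    rw [decay, ← Real.rpow_add h4]; simp
  have hW := fun i => invWeightSq_pos s b (z i)
  unfold quinticKernel
  rw [Fin.prod_univ_five]
  calc _ ≤ (5 ^ 2 * bracket (z 4 1) ^ 2) * (5 ^ (2 * s) * bracket (z 4 1) ^ (2 * s)) *
        (invWeightSq s b (z 0) * invWeightSq s b (z 1) * invWeightSq s b (z 2) *
          invWeightSq s b (z 3) * invWeightSq s b (z 4)) := by
        refine mul_le_mul_of_nonneg_right h1 ?_
        have := hW 0; have := hW 1; have := hW 2; have := hW 3; have := hW 4
        positivity
    _ = _ := by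
        rw [show invWeightSq s b (z 4) = modDecay b (z 4) * decay s (z 4 1) from rfl]
        linear_combination (5 ^ 2 * bracket (z 4 1) ^ 2 * 5 ^ (2 * s) * modDecay b (z 4) *
          (invWeightSq s b (z 0) * invWeightSq s b (z 1) * invWeightSq s b (z 2) *
          invWeightSq s b (z 3))) * h2

lemma quinticKernel_le_transversal {s b : ℝ} (hs : 0 ≤ s) {z : Fin 5 → Spacetime}
    (hz : ∀ i, |z i 1| ≤ |z 4 1|)
    (h : bracket (z 4 1) ^ 2 * decay s (z 3 1) ≤ 8 * |z 4 1 ^ 2 - z 3 1 ^ 2|) :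
    quinticKernel s b z ≤ (5 ^ 2 * 5 ^ (2 * s)) * (8 * transversalKernel s b z) := by
  refine (quinticKernel_le_of_max hs hz).trans (mul_le_mul_of_nonneg_left ?_ (by positivity))
  have h0 := invWeightSq_pos s b (z 0)
  have h1 := invWeightSq_pos s b (z 1)
  have h2 := invWeightSq_pos s b (z 2)
  have m3 := modDecay_pos b (z 3)
  have m4 := modDecay_pos b (z 4)
  rw [show invWeightSq s b (z 3) = modDecay b (z 3) * decay s (z 3 1) from rfl, transversalKernel]
  have := mul_le_mul_of_nonneg_left h (by positivity : 0 ≤ modDecay b (z 4) * modDecay b (z 3) *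
    (invWeightSq s b (z 0) * invWeightSq s b (z 1) * invWeightSq s b (z 2)))
  linarith

/-- As 2s ≥ 1, the weights of slots 2 and 3 each absorb one power of ⟨ξ₄⟩. Slot 1 keeps its
integrable weight and serves as reference for the two indicators, while slot 4 gives up its
modulation weight so that its variable is free to integrate the test function. -/
lemma quinticKernel_le_parallel {s b : ℝ} (hs : 1 / 2 ≤ s) (hb : 0 ≤ b) {z : Fin 5 → Spacetime}
    (hz : ∀ i, |z i 1| ≤ |z 4 1|)
    (h : ∀ i : Fin 5, i = 1 ∨ i = 2 ∨ i = 3 →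
      bracket (z 4 1) ≤ 2 * bracket (z i 1) ∧ |z 4 1| - |z i 1| ≤ 1) :
    quinticKernel s b z ≤ (5 ^ 2 * 5 ^ (2 * s)) * (4 * parallelKernel s b z) := by
  refine (quinticKernel_le_of_max (by linarith) hz).trans
    (mul_le_mul_of_nonneg_left ?_ (by positivity))
  obtain ⟨-, n1⟩ := h 1 (by simp)
  obtain ⟨b2, n2⟩ := h 2 (by simp)
  obtain ⟨b3, n3⟩ := h 3 (by simp)
  have hn2 : nearIndicator (z 2 1) (z 1 1) = 1 :=
    if_pos (abs_le.2 ⟨by linarith [hz 1], by linarith [hz 2]⟩)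
  have hn3 : nearIndicator (z 3 1) (z 1 1) = 1 :=
    if_pos (abs_le.2 ⟨by linarith [hz 1], by linarith [hz 3]⟩)
  rw [parallelKernel, hn2, hn3]
  have p2 := bracket_pos (z 2 1)
  have p3 := bracket_pos (z 3 1)
  have p4 := bracket_pos (z 4 1)
  have key : bracket (z 4 1) ^ 2 * (decay s (z 2 1) * decay s (z 3 1)) ≤ 4 := by
    calc bracket (z 4 1) ^ 2 * (decay s (z 2 1) * decay s (z 3 1))
        ≤ ((2 * bracket (z 2 1)) * (2 * bracket (z 3 1))) *
          ((bracket (z 2 1))⁻¹ * (bracket (z 3 1))⁻¹) := by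
          rw [sq]
          gcongr
          · exact mul_nonneg (decay_pos _ _).le (decay_pos _ _).le
          · exact (decay_pos _ _).le
          · exact decay_le_inv_bracket hs _
          · exact decay_le_inv_bracket hs _
      _ = 4 := by field_simp; norm_num
  have h0 := invWeightSq_pos s b (z 0)
  have h1 := invWeightSq_pos s b (z 1)
  have m2 := modDecay_pos b (z 2)
  have m3 := modDecay_pos b (z 3)
  have m4 : modDecay b (z 4) ≤ 1 := decay_le_one hb _
  rw [show invWeightSq s b (z 2) = modDecay b (z 2) * decay s (z 2 1) from rfl,
    show invWeightSq s b (z 3) = modDecay b (z 3) * decay s (z 3 1) from rfl]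
  have := mul_le_mul key m4 (modDecay_pos b _).le (by norm_num)
  have := mul_le_mul_of_nonneg_left this (by positivity : 0 ≤ modDecay b (z 2) *
    modDecay b (z 3) * (invWeightSq s b (z 0) * invWeightSq s b (z 1)))
  linarith

lemma exists_perm_quinticKernel_le {s b : ℝ} (hs : 1 / 2 ≤ s) (hb : 0 ≤ b)
    (z : Fin 5 → Spacetime) : ∃ σ : Equiv.Perm (Fin 5), quinticKernel s b z ≤
      (5 ^ 2 * 5 ^ (2 * s) * 8) *
        (transversalKernel s b (z ∘ σ) + parallelKernel s b (z ∘ σ)) := by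
  have hs0 : 0 ≤ s := by linarith
  obtain ⟨k, hk⟩ := Finite.exists_max fun i => |z i 1|
  set w : Fin 5 → Spacetime := z ∘ Equiv.swap 4 k with hw
  have hwmax : ∀ i, |w i 1| ≤ |w 4 1| := fun i => by
    simpa [hw] using hk (Equiv.swap 4 k i)
  have hC : (0 : ℝ) < 5 ^ 2 * 5 ^ (2 * s) := by positivity
  by_cases hgood : ∃ j : Fin 5, (j = 1 ∨ j = 2 ∨ j = 3) ∧
      bracket (w 4 1) ^ 2 * decay s (w j 1) ≤ 8 * |w 4 1 ^ 2 - w j 1 ^ 2|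
  · obtain ⟨j, hj, hgood⟩ := hgood
    -- The second transposition brings j to slot 3 and leaves the maximum in slot 4.
    have hj4 : Equiv.swap 3 j 4 = 4 :=
      Equiv.swap_apply_of_ne_of_ne (by decide) (by rcases hj with rfl | rfl | rfl <;> decide)
    refine ⟨(Equiv.swap 3 j).trans (Equiv.swap 4 k), ?_⟩
    have hcomp : z ∘ (Equiv.swap 3 j).trans (Equiv.swap 4 k) = w ∘ Equiv.swap 3 j := rfl
    have := quinticKernel_le_transversal (b := b) hs0 (z := w ∘ Equiv.swap 3 j)
      (fun i => by simpa [hj4] using hwmax _) (by simpa [hj4] using hgood)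
    rw [hcomp, ← quinticKernel_comp_perm s b z (Equiv.swap 4 k), ← hw,
      ← quinticKernel_comp_perm s b w (Equiv.swap 3 j)]
    have := mul_nonneg hC.le (parallelKernel_nonneg s b (w ∘ Equiv.swap 3 j))
    linarith
  · push Not at hgood
    refine ⟨Equiv.swap 4 k, ?_⟩
    have := quinticKernel_le_parallel hs hb hwmax fun i hi =>
      near_of_not_transversal hs (hwmax i) (not_le.2 (hgood i hi))
    rw [← quinticKernel_comp_perm s b z (Equiv.swap 4 k), ← hw]
    have := mul_nonneg hC.le (parallelKernel_nonneg s b w)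
    have := mul_nonneg hC.le (transversalKernel_nonneg s b w)
    linarith

/-! ### Integration of the two majorants. -/

lemma lintegral_comp_perm {α : Type*} [MeasureSpace α] [SigmaFinite (volume : Measure α)] {n : ℕ}
    (σ : Equiv.Perm (Fin n)) {F : (Fin n → α) → ℝ≥0∞} (hF : Measurable F) :
    ∫⁻ z, F (z ∘ σ) = ∫⁻ z, F z := by
  rw [← (volume_measurePreserving_piCongrLeft (fun _ : Fin n => α) σ.symm).lintegral_comp hF]
  refine lintegral_congr fun z => congrArg F (funext fun i => ?_)
  obtain ⟨j, rfl⟩ := σ.symm.surjective i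
  rw [MeasurableEquiv.coe_piCongrLeft, Equiv.piCongrLeft_apply_apply]
  simp

/-- In the variable ζ = z + z' the function g no longer depends on z, and the z-integral is bounded
uniformly in ζ by `lintegral_pair_le`. -/
lemma lintegral_lintegral_transversal_le (b : ℝ) {g : Spacetime → ℝ≥0∞} (hg : Measurable g)
    (w : Spacetime) :
    ∫⁻ z : Spacetime, ∫⁻ z' : Spacetime, ENNReal.ofReal |z' 1 ^ 2 - z 1 ^ 2| *
        (ENNReal.ofReal (modDecay b z') * ENNReal.ofReal (modDecay b z)) * g (w + z + z') ≤
      2 * (∫⁻ y, ENNReal.ofReal (decay b y)) ^ 2 * ∫⁻ ζ, g ζ := by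
  calc _ = ∫⁻ z : Spacetime, ∫⁻ ζ : Spacetime, (ENNReal.ofReal |(ζ 1 - z 1) ^ 2 - z 1 ^ 2| *
        (ENNReal.ofReal (modDecay b (ζ - z)) * ENNReal.ofReal (modDecay b z))) * g (w + ζ) := by
        refine lintegral_congr fun z => ?_
        rw [← lintegral_sub_right_eq_self _ z]
        refine lintegral_congr fun ζ => ?_
        rw [show w + z + (ζ - z) = w + ζ by abel]
        rfl
    _ = ∫⁻ ζ : Spacetime, (∫⁻ z : Spacetime, ENNReal.ofReal |(ζ 1 - z 1) ^ 2 - z 1 ^ 2| *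
        (ENNReal.ofReal (modDecay b (ζ - z)) * ENNReal.ofReal (modDecay b z))) * g (w + ζ) := by
        rw [lintegral_lintegral_swap (by fun_prop)]
        refine lintegral_congr fun ζ => ?_
        rw [lintegral_mul_const _ (by fun_prop)]
    _ ≤ ∫⁻ ζ : Spacetime, (2 * (∫⁻ y, ENNReal.ofReal (decay b y)) ^ 2) * g (w + ζ) :=
        lintegral_mono fun ζ => mul_le_mul_left (lintegral_pair_le b ζ) _
    _ = _ := by
        rw [lintegral_const_mul _ (by fun_prop), lintegral_add_left_eq_self g]

lemma lintegral_transversalKernel_le {s b : ℝ} {g : Spacetime → ℝ≥0∞} (hg : Measurable g) :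
    ∫⁻ z, ENNReal.ofReal (transversalKernel s b z) * g (∑ i, z i) ≤
      (∫⁻ ζ, ENNReal.ofReal (invWeightSq s b ζ)) ^ 3 *
        (2 * (∫⁻ y, ENNReal.ofReal (decay b y)) ^ 2) * ∫⁻ ζ, g ζ := by
  set A := ∫⁻ ζ, ENNReal.ofReal (invWeightSq s b ζ)
  set B := 2 * (∫⁻ y, ENNReal.ofReal (decay b y)) ^ 2 * ∫⁻ ζ, g ζ with hB
  have hW := fun ζ => (invWeightSq_pos s b ζ).le
  have hm := fun ζ => (modDecay_pos b ζ).le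
  have hc : ∀ c : ℝ≥0∞, ∫⁻ ζ, ENNReal.ofReal (invWeightSq s b ζ) * c = A * c := fun c =>
    lintegral_mul_const _ (by fun_prop)
  rw [lintegral_fin_five (by fun_prop)]
  simp only [transversalKernel, Fin.sum_univ_five, ENNReal.ofReal_mul, hW, hm, abs_nonneg,
    Matrix.cons_val]
  calc _ = ∫⁻ z₀ : Spacetime, ENNReal.ofReal (invWeightSq s b z₀) *
        ∫⁻ z₁ : Spacetime, ENNReal.ofReal (invWeightSq s b z₁) *
        ∫⁻ z₂ : Spacetime, ENNReal.ofReal (invWeightSq s b z₂) *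
        ∫⁻ z : Spacetime, ∫⁻ z' : Spacetime, ENNReal.ofReal |z' 1 ^ 2 - z 1 ^ 2| *
        (ENNReal.ofReal (modDecay b z') * ENNReal.ofReal (modDecay b z)) *
          g (z₀ + z₁ + z₂ + z + z') := by
        simp_rw [mul_assoc]
        congr! 2 with z₀
        rw [← lintegral_const_mul' _ _ ENNReal.ofReal_ne_top]
        congr! 2 with z₁
        rw [← lintegral_const_mul' _ _ ENNReal.ofReal_ne_top,
          ← lintegral_const_mul' _ _ ENNReal.ofReal_ne_top]
        congr! 2 with z₂
        simp_rw [← lintegral_const_mul' _ _ ENNReal.ofReal_ne_top]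
    _ ≤ ∫⁻ z₀ : Spacetime, ENNReal.ofReal (invWeightSq s b z₀) *
        ∫⁻ z₁ : Spacetime, ENNReal.ofReal (invWeightSq s b z₁) *
        ∫⁻ z₂ : Spacetime, ENNReal.ofReal (invWeightSq s b z₂) * B := by
        gcongr with z₀ z₁ z₂
        exact lintegral_lintegral_transversal_le b hg _
    _ = _ := by simp_rw [hc, hB]; ring

lemma lintegral_parallelKernel_le {s b : ℝ} {g : Spacetime → ℝ≥0∞} (hg : Measurable g) :
    ∫⁻ z, ENNReal.ofReal (parallelKernel s b z) * g (∑ i, z i) ≤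
      (∫⁻ ζ, ENNReal.ofReal (invWeightSq s b ζ)) ^ 2 *
        ((∫⁻ y, ENNReal.ofReal (decay b y)) * 4) ^ 2 * ∫⁻ ζ, g ζ := by
  set A := ∫⁻ ζ, ENNReal.ofReal (invWeightSq s b ζ)
  set B := (∫⁻ y, ENNReal.ofReal (decay b y)) * 4 with hB
  have hW := fun ζ => (invWeightSq_pos s b ζ).le
  have hm := fun ζ => (modDecay_pos b ζ).le
  have hc : ∀ c : ℝ≥0∞, ∫⁻ ζ, ENNReal.ofReal (invWeightSq s b ζ) * c = A * c := fun c =>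
    lintegral_mul_const _ (by fun_prop)
  have hN : ∀ (x : ℝ) (c : ℝ≥0∞), ∫⁻ ζ : Spacetime, ENNReal.ofReal (modDecay b ζ) *
      ENNReal.ofReal (nearIndicator (ζ 1) x) * c ≤ B * c := fun x c => by
    rw [lintegral_mul_const _ (by fun_prop),
      lintegral_modDecay_mul b (f := fun y => ENNReal.ofReal (nearIndicator y x)) (by fun_prop)]
    exact mul_le_mul_left (mul_le_mul_right (lintegral_nearIndicator_le x) _) _
  rw [lintegral_fin_five (by fun_prop)]
  simp only [parallelKernel, Fin.sum_univ_five, ENNReal.ofReal_mul, hW, hm, mul_nonneg,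
    nearIndicator_nonneg, Matrix.cons_val]
  calc _ = ∫⁻ z₀ : Spacetime, ENNReal.ofReal (invWeightSq s b z₀) *
        ∫⁻ z₁ : Spacetime, ENNReal.ofReal (invWeightSq s b z₁) *
        ∫⁻ z₂ : Spacetime, ENNReal.ofReal (modDecay b z₂) *
          ENNReal.ofReal (nearIndicator (z₂ 1) (z₁ 1)) *
        ∫⁻ z₃ : Spacetime, ENNReal.ofReal (modDecay b z₃) *
          ENNReal.ofReal (nearIndicator (z₃ 1) (z₁ 1)) * ∫⁻ ζ, g ζ := by
        congr! 2 with z₀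
        rw [← lintegral_const_mul' _ _ ENNReal.ofReal_ne_top]
        congr! 2 with z₁
        rw [← lintegral_const_mul' _ _ ENNReal.ofReal_ne_top,
          ← lintegral_const_mul' _ _ ENNReal.ofReal_ne_top]
        congr! 2 with z₂
        rw [← lintegral_const_mul' _ _ (by finiteness), ← lintegral_const_mul' _ _ (by finiteness),
          ← lintegral_const_mul' _ _ (by finiteness)]
        congr! 2 with z₃
        -- The kernel does not depend on z₄, so translation invariance removes the other variables
        -- from g.
        rw [← lintegral_add_left_eq_self g (z₀ + z₁ + z₂ + z₃),
          lintegral_const_mul _ (by fun_prop)]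
        simp_rw [mul_assoc]
    _ ≤ ∫⁻ z₀ : Spacetime, ENNReal.ofReal (invWeightSq s b z₀) *
        ∫⁻ z₁ : Spacetime, ENNReal.ofReal (invWeightSq s b z₁) * (B * (B * ∫⁻ ζ, g ζ)) := by
        gcongr with z₀ z₁
        refine le_trans ?_ (hN (z₁ 1) _)
        gcongr with z₂
        exact hN _ _
    _ = _ := by simp_rw [hc]; ring

/-- The fivefold convolution of `invWeightSq s b` times `derivWeightSq s` is bounded. -/
lemma exists_lintegral_quinticKernel_le {s b : ℝ} (hs : 1 / 2 < s) (hb : 1 / 2 < b) :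
    ∃ C : ℝ≥0∞, C < ∞ ∧ ∀ g : Spacetime → ℝ≥0∞, Measurable g →
      ∫⁻ z, ENNReal.ofReal (quinticKernel s b z) * g (∑ i, z i) ≤ C * ∫⁻ ζ, g ζ := by
  set A := ∫⁻ ζ, ENNReal.ofReal (invWeightSq s b ζ) with hA
  set D := ∫⁻ y, ENNReal.ofReal (decay b y) with hD
  have hA' : A ≠ ∞ := (lintegral_invWeightSq_lt_top hs hb).ne
  have hD' : D ≠ ∞ := (lintegral_decay_lt_top hb).ne
  set E := A ^ 3 * (2 * D ^ 2) + A ^ 2 * (D * 4) ^ 2 with hE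
  have hE' : E ≠ ∞ := by finiteness
  set K := ENNReal.ofReal (5 ^ 2 * 5 ^ (2 * s) * 8)
  refine ⟨K * (Fintype.card (Equiv.Perm (Fin 5)) * E), ?_, fun g hg => ?_⟩
  · exact lt_top_iff_ne_top.2 (by finiteness)
  set F : (Fin 5 → Spacetime) → ℝ≥0∞ := fun z =>
    (ENNReal.ofReal (transversalKernel s b z) + ENNReal.ofReal (parallelKernel s b z)) *
      g (∑ i, z i) with hF
  have hFm : Measurable F := by fun_prop
  -- The good permutation depends on z; summing over all of them removes this dependence, and every
  -- summand has the same integral.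
  calc _ ≤ ∫⁻ z, K * ∑ σ : Equiv.Perm (Fin 5), F (z ∘ σ) := by
        refine lintegral_mono fun z => ?_
        obtain ⟨σ, hσ⟩ := exists_perm_quinticKernel_le (b := b) hs.le (by linarith) z
        calc _ ≤ K * F (z ∘ σ) := by
              simp only [hF, Function.comp_apply]
              rw [Equiv.sum_comp σ z, ← mul_assoc,
                ← ENNReal.ofReal_add (transversalKernel_nonneg _ _ _) (parallelKernel_nonneg _ _ _),
                ← ENNReal.ofReal_mul (by positivity)]
              gcongr
          _ ≤ _ := by
              gcongr
              exact Finset.single_le_sum (f := fun σ : Equiv.Perm (Fin 5) => F (z ∘ σ))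
                (fun _ _ => zero_le) (Finset.mem_univ σ)
    _ = K * ∑ _σ : Equiv.Perm (Fin 5), ∫⁻ z, F z := by
        have hm : ∀ σ : Equiv.Perm (Fin 5), Measurable fun z => F (z ∘ σ) := fun σ =>
          hFm.comp (measurable_pi_iff.2 fun i => measurable_pi_apply _)
        rw [lintegral_const_mul _ (Finset.measurable_sum _ fun σ _ => hm σ),
          lintegral_finsetSum _ fun σ _ => hm σ]
        simp_rw [lintegral_comp_perm _ hFm]
    _ ≤ K * ∑ _σ : Equiv.Perm (Fin 5), E * ∫⁻ ζ, g ζ := by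
        gcongr
        simp only [hF, add_mul]
        rw [lintegral_add_left (by fun_prop), hE, add_mul]
        exact add_le_add (lintegral_transversalKernel_le hg) (lintegral_parallelKernel_le hg)
    _ = _ := by simp [mul_assoc]

/-! ### Rescaling of frequencies, for the factor 2π in the Fourier transform. -/

lemma lintegral_comp_smul_eq {E : Type*} [NormedAddCommGroup E] [NormedSpace ℝ E]
    [MeasurableSpace E] [BorelSpace E] [FiniteDimensional ℝ E] (μ : Measure E)
    [μ.IsAddHaarMeasure] {c : ℝ} (hc : c ≠ 0) (f : E → ℝ≥0∞) :
    ∫⁻ x, f (c • x) ∂μ = ENNReal.ofReal |(c ^ Module.finrank ℝ E)⁻¹| * ∫⁻ x, f x ∂μ := by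
  have h := lintegral_map_equiv (μ := μ) f (Homeomorph.smulOfNeZero c hc).toMeasurableEquiv
  have h' : Measure.map ((Homeomorph.smulOfNeZero c hc : E ≃ₜ E).toMeasurableEquiv) μ =
      ENNReal.ofReal |(c ^ Module.finrank ℝ E)⁻¹| • μ := Measure.map_addHaar_smul μ hc
  rw [h', lintegral_smul_measure] at h
  exact h.symm

lemma exists_lintegral_quinticKernel_smul_le {s b c : ℝ} (hs : 1 / 2 < s) (hb : 1 / 2 < b)
    (hc : c ≠ 0) :
    ∃ C : ℝ≥0∞, C < ∞ ∧ ∀ g : Spacetime → ℝ≥0∞, Measurable g →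
      ∫⁻ z : Fin 5 → Spacetime, ENNReal.ofReal (quinticKernel s b (c • z)) * g (∑ i, z i) ≤
        C * ∫⁻ ζ, g ζ := by
  obtain ⟨C, hC, h⟩ := exists_lintegral_quinticKernel_le hs hb
  refine ⟨ENNReal.ofReal |(c ^ Module.finrank ℝ (Fin 5 → Spacetime))⁻¹| *
    (C * ENNReal.ofReal |(c⁻¹ ^ Module.finrank ℝ Spacetime)⁻¹|), ?_, fun g hg => ?_⟩
  · exact lt_top_iff_ne_top.2 (by have := hC.ne; finiteness)
  have h1 := lintegral_comp_smul_eq (volume : Measure (Fin 5 → Spacetime)) hc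
    fun z => ENNReal.ofReal (quinticKernel s b z) * g (c⁻¹ • ∑ i, z i)
  simp only [Pi.smul_apply, ← Finset.smul_sum, inv_smul_smul₀ hc] at h1
  rw [h1, mul_assoc, mul_assoc, ← lintegral_comp_smul_eq volume (inv_ne_zero hc)]
  gcongr
  exact h (fun ζ => g (c⁻¹ • ζ)) (by fun_prop)

/-! ### Fivefold convolutions and Cauchy–Schwarz. -/

lemma lintegral_lconvolution_mul {A B G : Spacetime → ℝ≥0∞} (hA : Measurable A)
    (hB : Measurable B) (hG : Measurable G) :
    ∫⁻ ζ, (A ⋆ₗ B) ζ * G ζ = ∫⁻ x, A x * ∫⁻ y, B y * G (x + y) := by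
  simp only [lconvolution_def]
  calc _ = ∫⁻ ζ, ∫⁻ x, A x * B (-x + ζ) * G ζ := by
        refine lintegral_congr fun ζ => ?_
        rw [lintegral_mul_const _ (by fun_prop)]
    _ = ∫⁻ x, A x * ∫⁻ ζ, B (-x + ζ) * G ζ := by
        rw [lintegral_lintegral_swap (by fun_prop)]
        refine lintegral_congr fun x => ?_
        simp_rw [mul_assoc]
        rw [lintegral_const_mul _ (by fun_prop)]
    _ = _ := by
        refine lintegral_congr fun x => ?_
        rw [← lintegral_add_left_eq_self _ x]
        simp

lemma le_rpow_half_iff {x y : ℝ≥0∞} : x ≤ y ^ (1 / 2 : ℝ) ↔ x ^ 2 ≤ y := by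
  rw [one_div, ENNReal.le_rpow_inv_iff (by norm_num), ENNReal.rpow_ofNat]

lemma lintegral_lconvolution {A B : Spacetime → ℝ≥0∞} (hA : Measurable A) (hB : Measurable B) :
    ∫⁻ ζ, (A ⋆ₗ B) ζ = (∫⁻ ζ, A ζ) * ∫⁻ ζ, B ζ := by
  have h := lintegral_lconvolution_mul hA hB (G := fun _ => 1) measurable_const
  simp only [mul_one] at h
  rw [h, lintegral_mul_const _ hA]

/-- Cauchy–Schwarz in the convolution variable. The conclusion has the form of the hypotheses, so
the bound iterates. -/
lemma sq_lconvolution_le {A B A₁ A₂ B₁ B₂ : Spacetime → ℝ≥0∞} (hA₁ : Measurable A₁)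
    (hA₂ : Measurable A₂) (hB₁ : Measurable B₁) (hB₂ : Measurable B₂)
    (hA : ∀ ζ, A ζ ^ 2 ≤ A₁ ζ * A₂ ζ) (hB : ∀ ζ, B ζ ^ 2 ≤ B₁ ζ * B₂ ζ) (ζ : Spacetime) :
    (A ⋆ₗ B) ζ ^ 2 ≤ (A₁ ⋆ₗ B₁) ζ * (A₂ ⋆ₗ B₂) ζ := by
  simp only [lconvolution_def]
  have hpow : ∀ x : ℝ≥0∞, (x ^ (1 / 2 : ℝ)) ^ (2 : ℝ) = x := fun x => by
    rw [← ENNReal.rpow_mul]; norm_num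
  have h1 : ∀ y, A y * B (-y + ζ) ≤
      (A₁ y * B₁ (-y + ζ)) ^ (1 / 2 : ℝ) * (A₂ y * B₂ (-y + ζ)) ^ (1 / 2 : ℝ) := fun y => by
    rw [← ENNReal.mul_rpow_of_nonneg _ _ (by norm_num : (0 : ℝ) ≤ 1 / 2),
      le_rpow_half_iff]
    calc _ = A y ^ 2 * B (-y + ζ) ^ 2 := mul_pow _ _ _
      _ ≤ (A₁ y * A₂ y) * (B₁ (-y + ζ) * B₂ (-y + ζ)) := mul_le_mul' (hA _) (hB _)
      _ = _ := by ring
  have h2 := ENNReal.lintegral_mul_le_Lp_mul_Lq volume Real.HolderConjugate.two_two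
    (f := fun y => (A₁ y * B₁ (-y + ζ)) ^ (1 / 2 : ℝ))
    (g := fun y => (A₂ y * B₂ (-y + ζ)) ^ (1 / 2 : ℝ)) (by fun_prop) (by fun_prop)
  simp only [hpow, Pi.mul_apply] at h2
  have h3 := (lintegral_mono h1).trans h2
  rwa [← ENNReal.mul_rpow_of_nonneg _ _ (by norm_num : (0 : ℝ) ≤ 1 / 2),
    le_rpow_half_iff] at h3

/-- The fivefold convolution of nonnegative functions. -/
def lconvFive (f : Fin 5 → Spacetime → ℝ≥0∞) : Spacetime → ℝ≥0∞ :=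
  f 0 ⋆ₗ (f 1 ⋆ₗ (f 2 ⋆ₗ (f 3 ⋆ₗ f 4)))

lemma measurable_lconvFive {f : Fin 5 → Spacetime → ℝ≥0∞} (hf : ∀ i, Measurable (f i)) :
    Measurable (lconvFive f) :=
  measurable_lconvolution _ (hf 0) <| measurable_lconvolution _ (hf 1) <|
    measurable_lconvolution _ (hf 2) <| measurable_lconvolution _ (hf 3) (hf 4)

/-- This passes from the convolution to an integral over five variables, where the permutation
symmetry can be used. -/
lemma lintegral_lconvFive_mul {f : Fin 5 → Spacetime → ℝ≥0∞} (hf : ∀ i, Measurable (f i))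
    {G : Spacetime → ℝ≥0∞} (hG : Measurable G) :
    ∫⁻ ζ, lconvFive f ζ * G ζ = ∫⁻ z : Fin 5 → Spacetime, (∏ i, f i (z i)) * G (∑ i, z i) := by
  have h34 := measurable_lconvolution volume (hf 3) (hf 4)
  have h24 := measurable_lconvolution volume (hf 2) h34
  have h14 := measurable_lconvolution volume (hf 1) h24
  rw [lintegral_fin_five (by fun_prop), lconvFive, lintegral_lconvolution_mul (hf 0) h14 hG]
  refine lintegral_congr fun z₀ => ?_
  rw [lintegral_lconvolution_mul (hf 1) h24 (by fun_prop), ← lintegral_const_mul _ (by fun_prop)]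
  refine lintegral_congr fun z₁ => ?_
  rw [lintegral_lconvolution_mul (hf 2) h34 (by fun_prop), ← lintegral_const_mul _ (by fun_prop),
    ← lintegral_const_mul _ (by fun_prop)]
  refine lintegral_congr fun z₂ => ?_
  rw [lintegral_lconvolution_mul (hf 3) (hf 4) (by fun_prop),
    ← lintegral_const_mul _ (by fun_prop), ← lintegral_const_mul _ (by fun_prop),
    ← lintegral_const_mul _ (by fun_prop)]
  refine lintegral_congr fun z₃ => ?_
  rw [← lintegral_const_mul _ (by fun_prop), ← lintegral_const_mul _ (by fun_prop),
    ← lintegral_const_mul _ (by fun_prop), ← lintegral_const_mul _ (by fun_prop)]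
  refine lintegral_congr fun z₄ => ?_
  simp only [Fin.prod_univ_five, Fin.sum_univ_five, Matrix.cons_val]
  simp only [← mul_assoc, ← add_assoc]

lemma lintegral_lconvFive {f : Fin 5 → Spacetime → ℝ≥0∞} (hf : ∀ i, Measurable (f i)) :
    ∫⁻ ζ, lconvFive f ζ = ∏ i, ∫⁻ ζ, f i ζ := by
  have h34 := measurable_lconvolution volume (hf 3) (hf 4)
  have h24 := measurable_lconvolution volume (hf 2) h34
  rw [lconvFive, lintegral_lconvolution (hf 0) (measurable_lconvolution _ (hf 1) h24),
    lintegral_lconvolution (hf 1) h24, lintegral_lconvolution (hf 2) h34,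
    lintegral_lconvolution (hf 3) (hf 4), Fin.prod_univ_five]
  simp only [mul_assoc]

/-- The fivefold convolution of complex functions. -/
def convFive (v : Fin 5 → Spacetime → ℂ) : Spacetime → ℂ :=
  convolution (v 0) (convolution (v 1) (convolution (v 2) (convolution (v 3) (v 4)
    (.mul ℂ ℂ)) (.mul ℂ ℂ)) (.mul ℂ ℂ)) (.mul ℂ ℂ)

lemma integrable_convFive {v : Fin 5 → Spacetime → ℂ} (hv : ∀ i, Integrable (v i)) :
    Integrable (convFive v) :=
  (hv 0).integrable_convolution _ <| (hv 1).integrable_convolution _ <|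
    (hv 2).integrable_convolution _ <| (hv 3).integrable_convolution _ (hv 4)

lemma fourierInv_convFive {v : Fin 5 → Spacetime → ℂ} (hv : ∀ i, Integrable (v i))
    (p : Spacetime) : 𝓕⁻ (convFive v) p = ∏ i, 𝓕⁻ (v i) p := by
  have h34 := (hv 3).integrable_convolution (.mul ℂ ℂ) (hv 4)
  have h24 := (hv 2).integrable_convolution (.mul ℂ ℂ) h34
  have h14 := (hv 1).integrable_convolution (.mul ℂ ℂ) h24
  simp only [Real.fourierInv_eq_fourier_neg, Fin.prod_univ_five]
  rw [convFive, Real.fourier_mul_convolution_eq (hv 0) h14,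
    Real.fourier_mul_convolution_eq (hv 1) h24, Real.fourier_mul_convolution_eq (hv 2) h34,
    Real.fourier_mul_convolution_eq (hv 3) (hv 4)]
  simp only [mul_assoc]

lemma enorm_convolution_le {u v : Spacetime → ℂ} {U V : Spacetime → ℝ≥0∞}
    (hu : ∀ ζ, ‖u ζ‖ₑ ≤ U ζ) (hv : ∀ ζ, ‖v ζ‖ₑ ≤ V ζ) (ζ : Spacetime) :
    ‖convolution u v (.mul ℂ ℂ) volume ζ‖ₑ ≤ (U ⋆ₗ V) ζ := by
  rw [convolution_def, lconvolution_def]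
  refine (enorm_integral_le_lintegral_enorm _).trans (lintegral_mono fun y => ?_)
  simp only [ContinuousLinearMap.mul_apply', enorm_mul]
  rw [show -y + ζ = ζ - y by abel]
  exact mul_le_mul' (hu _) (hv _)

lemma enorm_convFive_le (v : Fin 5 → Spacetime → ℂ) (ζ : Spacetime) :
    ‖convFive v ζ‖ₑ ≤ lconvFive (fun i ζ => ‖v i ζ‖ₑ) ζ :=
  enorm_convolution_le (fun _ => le_rfl) (enorm_convolution_le (fun _ => le_rfl)
    (enorm_convolution_le (fun _ => le_rfl) (enorm_convolution_le (fun _ => le_rfl)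
      (fun _ => le_rfl)))) ζ

lemma sq_lconvFive_le {A A₁ A₂ : Fin 5 → Spacetime → ℝ≥0∞} (h₁ : ∀ i, Measurable (A₁ i))
    (h₂ : ∀ i, Measurable (A₂ i)) (h : ∀ i ζ, A i ζ ^ 2 ≤ A₁ i ζ * A₂ i ζ) (ζ : Spacetime) :
    lconvFive A ζ ^ 2 ≤ lconvFive A₁ ζ * lconvFive A₂ ζ := by
  have m34 := measurable_lconvolution volume (h₁ 3) (h₁ 4)
  have m24 := measurable_lconvolution volume (h₁ 2) m34
  have m14 := measurable_lconvolution volume (h₁ 1) m24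
  have n34 := measurable_lconvolution volume (h₂ 3) (h₂ 4)
  have n24 := measurable_lconvolution volume (h₂ 2) n34
  have n14 := measurable_lconvolution volume (h₂ 1) n24
  exact sq_lconvolution_le (h₁ 0) (h₂ 0) m14 n14 (h 0) (sq_lconvolution_le (h₁ 1) (h₂ 1) m24 n24
    (h 1) (sq_lconvolution_le (h₁ 2) (h₂ 2) m34 n34 (h 2) (sq_lconvolution_le (h₁ 3) (h₂ 3)
      (h₁ 4) (h₂ 4) (h 3) (h 4)))) ζ

/-! ### The weighted estimate on the Fourier side. -/

lemma measurable_bourgainWeight (s b : ℝ) : Measurable (bourgainWeight s b) := by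
  have h : ∀ r : ℝ, Measurable fun y => bracket y ^ r := fun r =>
    (continuous_bracket.rpow_const fun y => Or.inl (bracket_pos y).ne').measurable
  unfold bourgainWeight
  exact ((h b).comp (by fun_prop : Measurable fun ζ : Spacetime => ζ 0 - ζ 1 ^ 3)).mul
    ((h s).comp (measurable_spacetime_apply 1))

/-- The weighted density `(w (cζ) |v ζ|) ^ 2`. -/
def weightedDensity (s b c : ℝ) (v : Spacetime → ℂ) (ζ : Spacetime) : ℝ≥0∞ :=
  ENNReal.ofReal (bourgainWeight s b (c • ζ) ^ 2) * ‖v ζ‖ₑ ^ 2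

lemma measurable_weightedDensity {s b c : ℝ} {v : Spacetime → ℂ} (hv : Measurable v) :
    Measurable (weightedDensity s b c v) := by
  have := measurable_bourgainWeight s b
  unfold weightedDensity
  fun_prop

lemma enorm_sq_eq_mul_weightedDensity (s b c : ℝ) (v : Spacetime → ℂ) (ζ : Spacetime) :
    ‖v ζ‖ₑ ^ 2 = ENNReal.ofReal (invWeightSq s b (c • ζ)) * weightedDensity s b c v ζ := by
  rw [weightedDensity, ← mul_assoc, ← ENNReal.ofReal_mul (invWeightSq_pos _ _ _).le,
    invWeightSq_mul_sq]
  simp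

/-- Functions of finite weighted norm are integrable. -/
lemma integrable_of_weightedDensity {s b c : ℝ} (hs : 1 / 2 < s) (hb : 1 / 2 < b) (hc : c ≠ 0)
    {v : Spacetime → ℂ} (hv : Measurable v) (h : ∫⁻ ζ, weightedDensity s b c v ζ < ∞) :
    Integrable v := by
  refine ⟨hv.aestronglyMeasurable, ?_⟩
  have hm := measurable_weightedDensity (s := s) (b := b) (c := c) hv
  have hI : ∫⁻ ζ : Spacetime, ENNReal.ofReal (invWeightSq s b (c • ζ)) < ∞ := by
    rw [lintegral_comp_smul_eq volume hc fun ζ => ENNReal.ofReal (invWeightSq s b ζ)]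
    exact ENNReal.mul_lt_top ENNReal.ofReal_lt_top (lintegral_invWeightSq_lt_top hs hb)
  refine lt_of_le_of_lt (lintegral_mono fun ζ => ?_)
    ((lintegral_add_left (by fun_prop) _).trans_lt (ENNReal.add_lt_top.2 ⟨hI, h⟩))
  -- Since |v|² is the product of the two summands, it would exceed that product if |v| exceeded
  -- their sum.
  by_contra! hlt
  have h1 := (le_self_add (a := ENNReal.ofReal (invWeightSq s b (c • ζ)))
    (b := weightedDensity s b c v ζ)).trans_lt hlt
  have h2 := (le_add_self (a := weightedDensity s b c v ζ)
    (b := ENNReal.ofReal (invWeightSq s b (c • ζ)))).trans_lt hlt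
  have := ENNReal.mul_lt_mul h1 h2
  rw [← sq] at this
  exact this.ne' (enorm_sq_eq_mul_weightedDensity s b c v ζ)

/-- The multilinear `L²` estimate on the Fourier side. -/
lemma exists_lintegral_convFive_le {s b c : ℝ} (hs : 1 / 2 < s) (hb : 1 / 2 < b) (hc : c ≠ 0) :
    ∃ C : ℝ≥0∞, C < ∞ ∧ ∀ v : Fin 5 → Spacetime → ℂ, (∀ i, Measurable (v i)) →
      ∫⁻ ζ : Spacetime, ENNReal.ofReal (derivWeightSq s (c * ζ 1)) * ‖convFive v ζ‖ₑ ^ 2 ≤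
        C * ∏ i, ∫⁻ ζ, weightedDensity s b c (v i) ζ := by
  obtain ⟨C, hC, h⟩ := exists_lintegral_quinticKernel_smul_le hs hb hc
  refine ⟨C, hC, fun v hv => ?_⟩
  set W : Fin 5 → Spacetime → ℝ≥0∞ := fun _ ζ => ENNReal.ofReal (invWeightSq s b (c • ζ)) with hW
  set F : Fin 5 → Spacetime → ℝ≥0∞ := fun i => weightedDensity s b c (v i)
  have hWm : ∀ i, Measurable (W i) := fun i => by fun_prop
  have hFm : ∀ i, Measurable (F i) := fun i => measurable_weightedDensity (hv i)
  have hFm' := measurable_lconvFive hFm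
  calc _ ≤ ∫⁻ ζ, lconvFive W ζ *
        (ENNReal.ofReal (derivWeightSq s (c * ζ 1)) * lconvFive F ζ) := by
        refine lintegral_mono fun ζ => ?_
        rw [mul_left_comm]
        gcongr
        exact (pow_le_pow_left' (enorm_convFive_le v ζ) 2).trans
          (sq_lconvFive_le hWm hFm
            (fun i ζ => (enorm_sq_eq_mul_weightedDensity s b c (v i) ζ).le) ζ)
    _ = ∫⁻ z : Fin 5 → Spacetime, ENNReal.ofReal (quinticKernel s b (c • z)) *
        lconvFive F (∑ i, z i) := by
        rw [lintegral_lconvFive_mul hWm (by fun_prop)]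
        refine lintegral_congr fun z => ?_
        rw [quinticKernel, mul_comm (derivWeightSq _ _), ENNReal.ofReal_mul
          (Finset.prod_nonneg fun i _ => (invWeightSq_pos _ _ _).le),
          ENNReal.ofReal_prod_of_nonneg fun i _ => (invWeightSq_pos _ _ _).le, mul_assoc]
        simp [hW, Finset.mul_sum]
    _ ≤ C * ∫⁻ ζ, lconvFive F ζ := h _ hFm'
    _ = _ := by rw [lintegral_lconvFive hFm]

/-! ### Distributions given by functions, and their Fourier transforms. -/

lemma IsGivenBy.locallyIntegrable {T : 𝓢'(Spacetime, ℂ)} {f : Spacetime → ℂ}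
    (h : IsGivenBy T f) : LocallyIntegrable f := by
  intro x
  -- Testing against a bump equal to 1 on the unit ball gives integrability there.
  let β : ContDiffBump x := ⟨1, 2, by norm_num, by norm_num⟩
  have h1 : HasCompactSupport (Complex.ofRealCLM ∘ β) := β.hasCompactSupport.comp_left rfl
  have h2 : ContDiff ℝ (⊤ : ℕ∞) (Complex.ofRealCLM ∘ β) := Complex.ofRealCLM.contDiff.comp β.contDiff
  have h3 := (h (h1.toSchwartzMap h2)).1
  refine ⟨Metric.closedBall x 1, Metric.closedBall_mem_nhds x one_pos, ?_⟩
  refine (h3.integrableOn (s := Metric.closedBall x 1)).congr_fun (fun y hy => ?_)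
    Metric.isClosed_closedBall.measurableSet
  have : β y = 1 := β.one_of_mem_closedBall hy
  simp [this]

lemma IsGivenBy.ae_eq {T : 𝓢'(Spacetime, ℂ)} {f g : Spacetime → ℂ}
    (hf : IsGivenBy T f) (hg : IsGivenBy T g) : f =ᵐ[volume] g := by
  refine ae_eq_of_integral_contDiff_smul_eq hf.locallyIntegrable hg.locallyIntegrable
    fun φ hφ hc => ?_
  have h1 : HasCompactSupport (Complex.ofRealCLM ∘ φ) := hc.comp_left rfl
  have h2 : ContDiff ℝ (⊤ : ℕ∞) (Complex.ofRealCLM ∘ φ) := Complex.ofRealCLM.contDiff.comp hφ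
  have h3 := (hf (h1.toSchwartzMap h2)).2.symm.trans (hg (h1.toSchwartzMap h2)).2
  simpa using h3

lemma IsGivenBy.congr {T : 𝓢'(Spacetime, ℂ)} {f g : Spacetime → ℂ}
    (hf : IsGivenBy T f) (hfg : f =ᵐ[volume] g) : IsGivenBy T g := fun φ => by
  have h : (fun p => φ p * f p) =ᵐ[volume] fun p => φ p * g p := by
    filter_upwards [hfg] with p hp
    rw [hp]
  exact ⟨(hf φ).1.congr h, by rw [(hf φ).2, integral_congr_ae h]⟩

lemma integrable_schwartz_mul (φ : 𝓢(Spacetime, ℂ)) {v : Spacetime → ℂ} (hv : Integrable v) :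
    Integrable fun p => φ p * v p :=
  hv.bdd_mul φ.continuous.aestronglyMeasurable
    (Filter.Eventually.of_forall fun p => φ.toBoundedContinuousFunction.norm_coe_le_norm p)

lemma norm_fourierInv_le (v : Spacetime → ℂ) (p : Spacetime) : ‖𝓕⁻ v p‖ ≤ ∫ ζ, ‖v ζ‖ :=
  VectorFourier.norm_fourierIntegral_le_integral_norm _ _ _ _ _

lemma continuous_neg_innerₗ :
    Continuous fun p : Spacetime × Spacetime => (-innerₗ Spacetime) p.1 p.2 := by
  change Continuous fun p : Spacetime × Spacetime => -inner ℝ p.1 p.2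
  fun_prop

lemma continuous_fourierInv {v : Spacetime → ℂ} (hv : Integrable v) : Continuous (𝓕⁻ v) :=
  VectorFourier.fourierIntegral_continuous Real.continuous_fourierChar continuous_neg_innerₗ hv

lemma integral_fourierInv_mul_eq_of_integrable {f g : Spacetime → ℂ} (hf : Integrable f)
    (hg : Integrable g) : ∫ ζ, 𝓕⁻ f ζ * g ζ = ∫ p, f p * 𝓕⁻ g p := by
  have h := VectorFourier.integral_fourierIntegral_smul_eq_flip (L := -innerₗ Spacetime)
    Real.continuous_fourierChar continuous_neg_innerₗ hf hg
  have hflip : (-innerₗ Spacetime).flip = -innerₗ Spacetime := by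
    ext x y
    simp [real_inner_comm]
  rw [hflip] at h
  exact h

/-- Testing `𝓕 T` on `𝓕⁻ φ` recovers `T φ`; the transform then moves onto v by Fubini. -/
lemma IsGivenBy.fourierInv {T : 𝓢'(Spacetime, ℂ)} {v : Spacetime → ℂ} (hv : Integrable v)
    (h : IsGivenBy (𝓕 T) v) : IsGivenBy T (𝓕⁻ v) := fun φ => by
  refine ⟨φ.integrable.mul_bdd (c := ∫ ζ, ‖v ζ‖)
    (continuous_fourierInv hv).aestronglyMeasurable
    (Filter.Eventually.of_forall (norm_fourierInv_le v)), ?_⟩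
  have h1 := (h (𝓕⁻ φ)).2
  rw [TemperedDistribution.fourier_apply, FourierTransform.fourier_fourierInv_eq] at h1
  rw [h1, ← integral_fourierInv_mul_eq_of_integrable φ.integrable hv, SchwartzMap.fourierInv_coe]

lemma exists_isGivenBy_fourier {v : Spacetime → ℂ} (hv : Integrable v) :
    ∃ T : 𝓢'(Spacetime, ℂ), IsGivenBy (𝓕 T) v := by
  have hv' : MemLp v 1 := memLp_one_iff_integrable.2 hv
  refine ⟨𝓕⁻ (Lp.toTemperedDistribution (hv'.toLp v)), fun φ =>
    ⟨integrable_schwartz_mul φ hv, ?_⟩⟩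
  rw [FourierTransform.fourier_fourierInv_eq, Lp.toTemperedDistribution_apply]
  refine integral_congr_ae ?_
  filter_upwards [hv'.coeFn_toLp] with p hp
  rw [hp, smul_eq_mul]

lemma IsGivenBy.fourier_spaceDeriv {T : 𝓢'(Spacetime, ℂ)} {v : Spacetime → ℂ}
    (h : IsGivenBy (𝓕 T) v) :
    IsGivenBy (𝓕 (spaceDeriv T)) fun ζ => 2 * Real.pi * Complex.I * ζ 1 * v ζ := fun φ => by
  set e : Spacetime := EuclideanSpace.single (1 : Fin 2) (1 : ℝ) with he
  have hg' : (fun ζ : Spacetime => ((inner ℝ ζ e : ℝ) : ℂ)).HasTemperateGrowth := by fun_prop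
  obtain ⟨h1, h2⟩ := h (SchwartzMap.smulLeftCLM ℂ (fun ζ => ((inner ℝ ζ e : ℝ) : ℂ)) φ)
  have hfun : ∀ ζ : Spacetime, φ ζ * (2 * Real.pi * Complex.I * ζ 1 * v ζ) =
      (2 * Real.pi * Complex.I) *
        (SchwartzMap.smulLeftCLM ℂ (fun ζ => ((inner ℝ ζ e : ℝ) : ℂ)) φ ζ * v ζ) := fun ζ => by
    rw [SchwartzMap.smulLeftCLM_apply_apply hg']
    simp only [he, EuclideanSpace.inner_single_right, smul_eq_mul]
    simp
    ring
  simp_rw [hfun]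
  refine ⟨h1.const_mul _, ?_⟩
  rw [integral_const_mul, ← h2, spaceDeriv, TemperedDistribution.fourier_lineDerivOp_eq]
  rfl

/-! ### The Bourgain norm in the normalisation of `𝓕`. -/

/-- Every admissible `u'` agrees almost everywhere with the rescaled v, so the infimum is over equal
values. The factor (2π)² is the Jacobian of ζ ↦ 2πζ in the plane. -/
lemma bourgainNorm_eq {s b : ℝ} {T : 𝓢'(Spacetime, ℂ)} {v : Spacetime → ℂ}
    (h : IsGivenBy (𝓕 T) v) :
    bourgainNorm s b T = (ENNReal.ofReal ((2 * Real.pi) ^ 2) *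
      ∫⁻ ζ, weightedDensity s b (2 * Real.pi) v ζ) ^ (1 / 2 : ℝ) := by
  have hπ : 2 * Real.pi ≠ 0 := by positivity
  have key : ∀ u' : Spacetime → ℂ, HasFourierFunction T u' →
      eLpNorm (fun ζ => (bourgainWeight s b ζ : ℂ) * u' ζ) 2 =
        (ENNReal.ofReal ((2 * Real.pi) ^ 2) *
          ∫⁻ ζ, weightedDensity s b (2 * Real.pi) v ζ) ^ (1 / 2 : ℝ) := fun u' hu' => by
    rw [eLpNorm_eq_lintegral_rpow_enorm_toReal (by norm_num) (by norm_num)]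
    simp only [ENNReal.toReal_ofNat, ENNReal.rpow_ofNat]
    congr 1
    have h1 := lintegral_comp_smul_eq (volume : Measure Spacetime) hπ
      fun ζ => ‖(bourgainWeight s b ζ : ℂ) * u' ζ‖ₑ ^ 2
    have h2 : ∫⁻ ζ, weightedDensity s b (2 * Real.pi) v ζ = ∫⁻ ζ : Spacetime,
        ‖(bourgainWeight s b ((2 * Real.pi) • ζ) : ℂ) * u' ((2 * Real.pi) • ζ)‖ₑ ^ 2 := by
      refine lintegral_congr_ae ?_
      filter_upwards [h.ae_eq hu'] with ζ hζ
      rw [weightedDensity, hζ, enorm_mul, mul_pow, ENNReal.ofReal_pow (bourgainWeight_pos _ _ _).le]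
      congr 2
      rw [← ofReal_norm, Complex.norm_real, Real.norm_of_nonneg (bourgainWeight_pos _ _ _).le]
    rw [h2, h1, ← mul_assoc, ← ENNReal.ofReal_mul (by positivity), finrank_euclideanSpace_fin,
      abs_of_pos (by positivity), mul_inv_cancel₀ (by positivity)]
    simp
  have hv : HasFourierFunction T fun ζ => v ((2 * Real.pi)⁻¹ • ζ) := by
    simpa only [HasFourierFunction, inv_smul_smul₀ hπ] using h
  refine le_antisymm ((iInf₂_le _ hv).trans (key _ hv).le) (le_iInf₂ fun u' hu' => (key u' hu').ge)

lemma MemBourgain.exists_fourier {s b : ℝ} {T : 𝓢'(Spacetime, ℂ)} (h : MemBourgain s b T) :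
    ∃ v : Spacetime → ℂ, Measurable v ∧ IsGivenBy (𝓕 T) v := by
  obtain ⟨u', hu', -⟩ : ∃ u', ∃ _ : HasFourierFunction T u', _ := by
    simpa only [MemBourgain, bourgainNorm, iInf_lt_iff] using h
  have hm := (IsGivenBy.locallyIntegrable hu').aestronglyMeasurable.aemeasurable
  exact ⟨hm.mk _, hm.measurable_mk, IsGivenBy.congr hu' hm.ae_eq_mk⟩

lemma MemBourgain.integrable {s b : ℝ} (hs : 1 / 2 < s) (hb : 1 / 2 < b)
    {T : 𝓢'(Spacetime, ℂ)} (h : MemBourgain s b T) {v : Spacetime → ℂ} (hm : Measurable v)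
    (hv : IsGivenBy (𝓕 T) v) : Integrable v := by
  refine integrable_of_weightedDensity (c := 2 * Real.pi) hs hb (by positivity) hm ?_
  rw [MemBourgain, bourgainNorm_eq hv, ENNReal.rpow_lt_top_iff_of_pos (by norm_num)] at h
  by_contra! htop
  rw [top_le_iff.1 htop, ENNReal.mul_top] at h
  · exact lt_irrefl _ h
  · simp only [ne_eq, ENNReal.ofReal_eq_zero, not_le]; positivity

lemma weightedDensity_deriv_le {s b' : ℝ} (hb' : b' ≤ 0) (v : Spacetime → ℂ) (ζ : Spacetime) :
    weightedDensity s b' (2 * Real.pi) (fun ζ => 2 * Real.pi * Complex.I * ζ 1 * v ζ) ζ ≤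
      ENNReal.ofReal (derivWeightSq s (2 * Real.pi * ζ 1)) * ‖v ζ‖ₑ ^ 2 := by
  have h1 : ‖2 * Real.pi * Complex.I * ζ 1 * v ζ‖ₑ ^ 2 =
      ENNReal.ofReal (|2 * Real.pi * ζ 1| ^ 2) * ‖v ζ‖ₑ ^ 2 := by
    rw [enorm_mul, mul_pow, ENNReal.ofReal_pow (abs_nonneg _)]
    congr 2
    rw [← ofReal_norm]
    simp [abs_mul]
  rw [weightedDensity, h1, ← mul_assoc, ← ENNReal.ofReal_mul (by positivity)]
  gcongr
  rw [derivWeightSq, mul_pow, mul_comm]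
  gcongr
  · exact (bourgainWeight_pos _ _ _).le
  · refine mul_le_of_le_one_left (Real.rpow_nonneg (bracket_pos _).le _) ?_
    exact Real.rpow_le_one_of_one_le_of_nonpos (one_le_bracket _) hb'

end

theorem lemma5p1 (s b : ℝ) (hs : 1 / 2 < s) (hb : 1 / 2 < b) :
    ∃ C : ℝ, 0 < C ∧ ∀ b' : ℝ, -(1 / 2) < b' → b' ≤ 0 →
      ∀ U : Fin 5 → 𝓢'(Spacetime, ℂ), (∀ j, MemBourgain s b (U j)) →
        -- the elements of the space are functions, so that their product makes sense
        (∃ u : Fin 5 → Spacetime → ℂ, ∀ j, IsGivenBy (U j) (u j)) ∧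
        ∀ u : Fin 5 → Spacetime → ℂ, (∀ j, IsGivenBy (U j) (u j)) →
          ∃ P : 𝓢'(Spacetime, ℂ), IsGivenBy P (fun p => ∏ j, u j p) ∧
            bourgainNorm s b' (spaceDeriv P) ≤
              ENNReal.ofReal C * ∏ j, bourgainNorm s b (U j) := by
  obtain ⟨K, hK, hest⟩ := exists_lintegral_convFive_le hs hb
    (by positivity : 2 * Real.pi ≠ 0)
  set k := ENNReal.ofReal ((2 * Real.pi) ^ 2) with hk
  have hk0 : k ≠ 0 := by simp only [hk, ne_eq, ENNReal.ofReal_eq_zero, not_le]; positivity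
  have hkt : k ≠ ∞ := ENNReal.ofReal_ne_top
  set D : ℝ≥0∞ := (k * K * (k⁻¹) ^ 5) ^ (1 / 2 : ℝ) with hD
  have hDt : D ≠ ∞ := by have := hK.ne; finiteness
  -- Adding 1 makes the constant positive even if `D` vanishes.
  refine ⟨D.toReal + 1, by positivity, fun b' _ hb' U hU => ?_⟩
  choose v hvm hv using fun j => (hU j).exists_fourier
  have hvi := fun j => (hU j).integrable hs hb (hvm j) (hv j)
  have hu₀ := fun j => (hv j).fourierInv (hvi j)
  refine ⟨⟨fun j => 𝓕⁻ (v j), hu₀⟩, fun u hu => ?_⟩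
  -- The product distribution is built from its Fourier transform, the fivefold convolution.
  obtain ⟨P, hP⟩ := exists_isGivenBy_fourier (integrable_convFive hvi)
  refine ⟨P, (hP.fourierInv (integrable_convFive hvi)).congr ?_, ?_⟩
  · filter_upwards [ae_all_iff.2 fun j => (hu₀ j).ae_eq (hu j)] with p hp
    rw [fourierInv_convFive hvi]
    exact Finset.prod_congr rfl fun j _ => hp j
  · rw [bourgainNorm_eq hP.fourier_spaceDeriv]
    simp_rw [bourgainNorm_eq (hv _)]
    rw [ENNReal.prod_rpow_of_nonneg (by norm_num : (0 : ℝ) ≤ 1 / 2), Finset.prod_mul_distrib,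
      Finset.prod_const, Finset.card_univ, Fintype.card_fin, ← hk]
    set Q := ∏ j, ∫⁻ ζ, weightedDensity s b (2 * Real.pi) (v j) ζ with hQ
    calc _ ≤ (k * (K * Q)) ^ (1 / 2 : ℝ) := by
          gcongr
          exact (lintegral_mono fun ζ => weightedDensity_deriv_le hb' _ ζ).trans (hest v hvm)
      _ = D * (k ^ 5 * Q) ^ (1 / 2 : ℝ) := by
          rw [hD, ← ENNReal.mul_rpow_of_nonneg _ _ (by norm_num : (0 : ℝ) ≤ 1 / 2)]
          congr 1
          -- Each of the five norms on the right carries a factor k = (2π)² under the root, which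
          -- `D` compensates.
          have : k⁻¹ ^ 5 * k ^ 5 = 1 := by
            rw [← mul_pow, ENNReal.inv_mul_cancel hk0 hkt, one_pow]
          calc k * (K * Q) = k * K * (k⁻¹ ^ 5 * k ^ 5) * Q := by rw [this]; ring
            _ = _ := by ring
      _ ≤ _ := by
          gcongr
          rw [← ENNReal.ofReal_toReal hDt]
          exact ENNReal.ofReal_le_ofReal (by simp)
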